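/- Let $n,m\ge 0$ be integers and let $F:\mathbb{R}^n\times\mathbb{R}^m\to\mathbb{R}^n$ be locally Lipschitz (every point has a neighbourhood on which $F$ is Lipschitz), where all norms are Euclidean. The Clarke generalized Jacobian $\partial F(x,y)$ is the convex hull of the set of all limits $\lim_{k\to\infty} F'(x_k,y_k)$, where $(x_k,y_k)\to(x,y)$, $F$ is differentiable at every $(x_k,y_k)$, and the limit exists. The partial generalized Jacobian $\partial_xF(x,y)$ is the set of all $n\times n$ matrices $M$ for which there is an $n\times m$ matrix $N$ with $[M,N]\in\partial F(x,y)$. Assume that (b1) for every $y\in\mathbb{R}^m$ the functional $\varphi_y(x)=\tfrac12\|F(x,y)\|^2$ on $\mathbb{R}^n$ is coercive, i.e. $\varphi_y(x)\to+\infty$ as $\|x\|\to\infty$; (b2) for all $(x,y)\in\mathbb{R}^n\times\mathbb{R}^m$ the set $\partial_xF(x,y)$ is of maximal rank, i.e. every matrix in it is nonsingular. Then there exists a unique locally Lipschitz function $f:\mathbb{R}^m\to\mathbb{R}^n$ such that for all $(x,y)\in\mathbb{R}^n\times\mathbb{R}^m$ one has $F(x,y)=0$ if and only if $x=f(y)$.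 -/

import Mathlib

open Filter Topology

/-- The Clarke generalized Jacobian of `f` at `x`: the convex hull of all limits of derivatives
`f' (u k)` along sequences `u k → x` of points at which `f` is differentiable. -/
def clarkeJacobian {E G : Type*} [NormedAddCommGroup E] [NormedSpace ℝ E]
    [NormedAddCommGroup G] [NormedSpace ℝ G] (f : E → G) (x : E) : Set (E →L[ℝ] G) :=
  convexHull ℝ {A | ∃ u : ℕ → E, (∀ k, DifferentiableAt ℝ f (u k)) ∧
    Tendsto u atTop (𝓝 x) ∧ Tendsto (fun k => fderiv ℝ f (u k)) atTop (𝓝 A)}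

/-- The partial Clarke generalized Jacobian with respect to the first variable: all blocks `M`
such that `[M, N]` lies in the generalized Jacobian of `F` at `(x, y)` for some `N`. -/
def partialClarkeJacobian {E H G : Type*} [NormedAddCommGroup E] [NormedSpace ℝ E]
    [NormedAddCommGroup H] [NormedSpace ℝ H] [NormedAddCommGroup G] [NormedSpace ℝ G]
    (F : E × H → G) (x : E) (y : H) : Set (E →L[ℝ] G) :=
  {M | ∃ N : H →L[ℝ] G, M.coprod N ∈ clarkeJacobian F (x, y)}

/-- A set of linear maps is of maximal rank if all its members are nonsingular. -/
def IsOfMaximalRank {E G : Type*} [NormedAddCommGroup E] [NormedSpace ℝ E]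
    [NormedAddCommGroup G] [NormedSpace ℝ G] (S : Set (E →L[ℝ] G)) : Prop :=
  ∀ M ∈ S, Function.Bijective M

/-- `φ x → +∞` as `‖x‖ → ∞`. -/
def IsCoerciveFunctional {E : Type*} [NormedAddCommGroup E] (φ : E → ℝ) : Prop :=
  Tendsto φ (comap (fun x : E => ‖x‖) atTop) atTop

/-! The partial Jacobian at a point is a compact convex set of invertible maps, and derivatives at
nearby points of differentiability have first blocks close to it. A mean value inequality tested
only at such points (Rademacher plus averaging) gives two facts. Separating the set of all `M v`
from 0 yields a local lower Lipschitz bound in `x`. And a local minimizer of `‖F (·, y) - p‖` solves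
`F (x, y) = p`: otherwise the vectors `M* q`, with `q` the residual, avoid 0, and separating them
from 0 gives a descent direction.

Minimizing over a small ball then gives local solvability, so each slice `F (·, y)` is a local
homeomorphism. Coercivity makes it proper, hence injective by Hadamard's theorem, so zeros are
unique; a global minimizer of `‖F (·, y)‖` is a zero. Local solvability makes `f` continuous, and
the lower bound in `x` against the Lipschitz bound in `y` makes it locally Lipschitz. -/

/-! ### Mean value inequality from almost everywhere derivatives -/

open MeasureTheory in
/-- If the derivative of a Lipschitz function in the direction `v` is almost everywhere at least `c`
on an open convex set, then its increments by `v` inside that set are at least `c`. -/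
theorem LipschitzWith.le_sub_of_ae_le_fderiv {X : Type*} [NormedAddCommGroup X] [NormedSpace ℝ X]
    [FiniteDimensional ℝ X] [MeasurableSpace X] [BorelSpace X] (μ : Measure X)
    [μ.IsAddHaarMeasure] {K : NNReal} {g : X → ℝ} (hg : LipschitzWith K g) {S : Set X}
    (hSo : IsOpen S) (hSc : Convex ℝ S) {v : X} {c : ℝ}
    (hc : ∀ᵐ z ∂μ, z ∈ S → c ≤ fderiv ℝ g z v) {p : X} (hp : p ∈ S) (hpv : p + v ∈ S) :
    c ≤ g (p + v) - g p := by
  by_contra! hlt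
  obtain ⟨c', hc'1, hc'2⟩ := exists_between hlt
  have hgc := hg.continuous
  have h1 : ∀ᶠ z in 𝓝 (0 : X), p + z ∈ S := by
    have : Tendsto (fun z => p + z) (𝓝 (0 : X)) (𝓝 p) :=
      Continuous.tendsto' (by fun_prop) _ _ (by simp)
    exact this (hSo.mem_nhds hp)
  have h2 : ∀ᶠ z in 𝓝 (0 : X), p + z + v ∈ S := by
    have : Tendsto (fun z => p + z + v) (𝓝 (0 : X)) (𝓝 (p + v)) :=
      Continuous.tendsto' (by fun_prop) _ _ (by simp)
    exact this (hSo.mem_nhds hpv)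
  have h3 : ∀ᶠ z in 𝓝 (0 : X), g (p + z + v) - g (p + z) < c' := by
    have : Tendsto (fun z => g (p + z + v) - g (p + z)) (𝓝 (0 : X)) (𝓝 (g (p + v) - g p)) :=
      Continuous.tendsto' (by fun_prop) _ _ (by simp)
    exact this.eventually (gt_mem_nhds hc'1)
  obtain ⟨ρ, hρ, hball⟩ := Metric.eventually_nhds_iff_ball.1 (h1.and (h2.and h3))
  set B := Metric.ball (0 : X) ρ
  have hBm : MeasurableSet B := measurableSet_ball
  have hBpos : 0 < μ.real B :=
    ENNReal.toReal_pos (Metric.measure_ball_pos μ _ hρ).ne' measure_ball_lt_top.ne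
  have : IsFiniteMeasure (μ.restrict B) := ⟨by simpa using measure_ball_lt_top⟩
  have hint : ∀ w : X, Integrable (fun z => g (p + z + w)) (μ.restrict B) := fun w =>
    ((by fun_prop : Continuous fun z => g (p + z + w)).continuousOn.integrableOn_compact
      (isCompact_closedBall (0 : X) ρ)).mono_set Metric.ball_subset_closedBall
  have htrans : ∀ (w : X) {P : X → Prop}, (∀ᵐ z ∂μ, P z) →
      ∀ᵐ z ∂(μ.restrict B), P (p + z + w) := fun w P h => by
    have := (measurePreserving_add_left μ (p + w)).quasiMeasurePreserving.ae h
    refine ae_restrict_of_ae (this.mono fun z hz => ?_)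
    rwa [add_right_comm] at hz
  -- The segment from `p` may miss every point of differentiability, but for each fixed `t` almost
  -- every translate by `z` hits one; averaging over `B` thus gives a derivative at every `t`.
  have hder : ∀ t : ℝ, Integrable (fun z => fderiv ℝ g (p + z + t • v) v) (μ.restrict B) ∧
      HasDerivAt (fun t : ℝ => ∫ z in B, g (p + z + t • v) ∂μ)
        (∫ z in B, fderiv ℝ g (p + z + t • v) v ∂μ) t := by
    intro t
    refine hasDerivAt_integral_of_dominated_loc_of_lip (s := Set.univ)
      (bound := fun _ => (K * ‖v‖ : ℝ)) univ_mem
      (Eventually.of_forall fun s => (hint _).aestronglyMeasurable) (hint _) ?_ ?_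
      (integrable_const _) ?_
    · exact ((measurable_fderiv_apply_const ℝ g v).comp (by fun_prop)).aestronglyMeasurable
    · refine Eventually.of_forall fun z => LipschitzWith.lipschitzOnWith ?_
      refine LipschitzWith.of_dist_le_mul fun s s' => ?_
      refine (hg.dist_le_mul _ _).trans ?_
      rw [dist_add_left, dist_eq_norm, ← sub_smul, norm_smul, Real.coe_nnabs,
        abs_of_nonneg (by positivity), Real.dist_eq, Real.norm_eq_abs]
      exact le_of_eq (by ring)
    · refine (htrans (t • v) hg.ae_differentiableAt).mono fun z hz => ?_
      have hl : HasDerivAt (fun s : ℝ => p + z + s • v) v t := by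
        simpa using ((hasDerivAt_id t).smul_const v).const_add (p + z)
      exact hz.hasFDerivAt.comp_hasDerivAt t hl
  have hle : ∀ t ∈ Set.Icc (0 : ℝ) 1,
      c * μ.real B ≤ ∫ z in B, fderiv ℝ g (p + z + t • v) v ∂μ := by
    intro t ht
    have hconst : c * μ.real B = ∫ _ in B, c ∂μ := by simp [mul_comm]
    rw [hconst]
    refine integral_mono_ae (integrable_const _) (hder t).1 ?_
    filter_upwards [htrans (t • v) hc, ae_restrict_mem hBm] with z hz hzB
    exact hz (hSc.add_smul_mem (hball z hzB).1 (hball z hzB).2.1 ht)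
  have hmv := Convex.mul_sub_le_image_sub_of_le_deriv (convex_Icc (0 : ℝ) 1)
    (f := fun t : ℝ => ∫ z in B, g (p + z + t • v) ∂μ)
    (fun t _ => (hder t).2.continuousAt.continuousWithinAt)
    (fun t _ => (hder t).2.differentiableAt.differentiableWithinAt)
    (C := c * μ.real B)
    (fun t ht => by
      rw [(hder t).2.deriv]
      exact hle t (interior_subset ht))
    0 (by simp) 1 (by simp) zero_le_one
  have hup : ∫ z in B, (g (p + z + (1 : ℝ) • v) - g (p + z + (0 : ℝ) • v)) ∂μ
      ≤ ∫ _ in B, c' ∂μ := by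
    refine setIntegral_mono_on ((hint _).sub (hint _)) (integrable_const _) hBm fun z hz => ?_
    simpa using (hball z hz).2.2.le
  rw [integral_sub (hint _) (hint _)] at hup
  simp only [integral_const, smul_eq_mul, MeasurableSet.univ, measureReal_restrict_apply,
    Set.univ_inter] at hup
  nlinarith

/-- Mean value inequality for Lipschitz maps, tested at the points of differentiability only. -/
theorem LipschitzOnWith.le_apply_sub_of_le_apply_fderiv {X G : Type*} [NormedAddCommGroup X]
    [NormedSpace ℝ X] [FiniteDimensional ℝ X] [NormedAddCommGroup G] [NormedSpace ℝ G]
    [FiniteDimensional ℝ G] {K : NNReal} {f : X → G} {S : Set X} (hf : LipschitzOnWith K f S)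
    (hSo : IsOpen S) (hSc : Convex ℝ S) (l : G →L[ℝ] ℝ) {v : X} {c : ℝ}
    (hc : ∀ z ∈ S, DifferentiableAt ℝ f z → c ≤ l (fderiv ℝ f z v)) {p : X} (hp : p ∈ S)
    (hpv : p + v ∈ S) : c ≤ l (f (p + v) - f p) := by
  borelize X
  obtain ⟨g, hg, hfg⟩ := (l.lipschitz.comp_lipschitzOnWith hf).extend_real
  have hae := hf.ae_differentiableWithinAt_of_mem (μ := MeasureTheory.Measure.addHaar)
  have := hg.le_sub_of_ae_le_fderiv MeasureTheory.Measure.addHaar hSo hSc (v := v) (c := c)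
    (hae.mono fun z hz hzS => by
      have hd : DifferentiableAt ℝ f z := (hz hzS).differentiableAt (hSo.mem_nhds hzS)
      have heq : g =ᶠ[𝓝 z] l ∘ f :=
        eventually_of_mem (hSo.mem_nhds hzS) fun y hy => (hfg hy).symm
      rw [heq.fderiv_eq, (l.hasFDerivAt.comp z hd.hasFDerivAt).fderiv]
      exact hc z hzS hd) hp hpv
  rwa [← hfg hp, ← hfg hpv, Function.comp_apply, Function.comp_apply, ← map_sub] at this

/-! ### Convex sets in finite dimension -/

/-- In a finite-dimensional space the convex hull of a compact set is compact. -/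
theorem IsCompact.convexHull_of_finiteDimensional {V : Type*} [NormedAddCommGroup V]
    [NormedSpace ℝ V] [FiniteDimensional ℝ V] {s : Set V} (hs : IsCompact s) :
    IsCompact (convexHull ℝ s) := by
  -- Carathéodory: at most `finrank + 1` points are needed, so the hull is a finite union of
  -- continuous images of compact sets.
  have key : convexHull ℝ s = ⋃ k ∈ Set.Iic (Module.finrank ℝ V + 1),
      (fun q : (Fin k → ℝ) × (Fin k → V) => ∑ i, q.1 i • q.2 i) ''
        (stdSimplex ℝ (Fin k) ×ˢ Set.pi Set.univ fun _ => s) := by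
    apply Set.Subset.antisymm
    · intro x hx
      obtain ⟨ι, _, z, w, hz, hind, hw, hw1, hx⟩ := eq_pos_convex_span_of_mem_convexHull hx
      simp only [Set.mem_iUnion]
      let e := Fintype.equivFin ι
      refine ⟨Fintype.card ι, hind.card_le_finrank_succ.trans
        (Nat.succ_le_succ (Submodule.finrank_le _)), (w ∘ e.symm, z ∘ e.symm),
        ⟨⟨fun i => (hw _).le, ?_⟩, fun i _ => hz ⟨_, rfl⟩⟩, ?_⟩
      · rw [← hw1]
        exact e.symm.sum_comp w
      · rw [← hx]
        exact e.symm.sum_comp fun i => w i • z i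
    · simp only [Set.iUnion_subset_iff]
      rintro k - _ ⟨⟨w, z⟩, ⟨hw, hz⟩, rfl⟩
      exact (convex_convexHull ℝ s).sum_mem (fun i _ => hw.1 i) hw.2
        fun i _ => subset_convexHull ℝ s (hz i trivial)
  rw [key]
  exact (Set.finite_Iic _).isCompact_biUnion fun k _ =>
    ((isCompact_stdSimplex ℝ (Fin k)).prod (isCompact_univ_pi fun _ => hs)).image (by fun_prop)

/-- A closed convex set outside the open ball of radius `δ` lies in a half-space at distance
`δ` from the origin. -/
theorem Convex.exists_le_inner_of_le_norm {V : Type*} [NormedAddCommGroup V]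
    [InnerProductSpace ℝ V] [CompleteSpace V] {C : Set V} (hC : Convex ℝ C) (hcl : IsClosed C)
    {δ : ℝ} (hδ : ∀ c ∈ C, δ ≤ ‖c‖) : ∃ w : V, ‖w‖ ≤ 1 ∧ ∀ c ∈ C, δ ≤ inner ℝ w c := by
  rcases C.eq_empty_or_nonempty with rfl | hne
  · exact ⟨0, by simp, by simp⟩
  -- The witness is the normalized point of least norm; if that point is 0, then `δ ≤ 0` and `w = 0`
  -- serves.
  obtain ⟨v, hv, hmin⟩ := exists_norm_eq_iInf_of_complete_convex hne hcl.isComplete hC 0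
  rw [norm_eq_iInf_iff_real_inner_le_zero hC hv] at hmin
  refine ⟨‖v‖⁻¹ • v, ?_, fun c hc => (hδ v hv).trans ?_⟩
  · rw [norm_smul, norm_inv, norm_norm]
    exact inv_mul_le_one
  · have h := hmin c hc
    rw [zero_sub, inner_neg_left, inner_sub_right, real_inner_self_eq_norm_sq] at h
    rw [real_inner_smul_left]
    rcases (norm_nonneg v).eq_or_lt with h0 | h0
    · simp [← h0]
    · rw [inv_mul_eq_div, le_div_iff₀ h0]
      nlinarith

/-! ### Compactness and outer semicontinuity of the Clarke Jacobian -/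

section Clarke

variable {X G : Type*} [NormedAddCommGroup X] [NormedSpace ℝ X] [NormedAddCommGroup G]
  [NormedSpace ℝ G]

/-- The set of limits of derivatives of `f` along sequences tending to `x`; the Clarke Jacobian is
its convex hull. -/
def derivLimits (f : X → G) (x : X) : Set (X →L[ℝ] G) :=
  {A | ∃ u : ℕ → X, (∀ k, DifferentiableAt ℝ f (u k)) ∧
    Tendsto u atTop (𝓝 x) ∧ Tendsto (fun k => fderiv ℝ f (u k)) atTop (𝓝 A)}

theorem mem_derivLimits_iff {f : X → G} {x : X} {A : X →L[ℝ] G} :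
    A ∈ derivLimits f x ↔ ∀ ε > 0, ∃ u, DifferentiableAt ℝ f u ∧ dist u x < ε ∧
      dist (fderiv ℝ f u) A < ε := by
  constructor
  · rintro ⟨u, hd, hu, hA⟩ ε hε
    obtain ⟨k, h1, h2⟩ := ((Metric.tendsto_nhds.1 hu ε hε).and (Metric.tendsto_nhds.1 hA ε hε)).exists
    exact ⟨u k, hd k, h1, h2⟩
  · intro h
    choose u hd hu hA using fun k : ℕ => h (1 / ((k : ℝ) + 1)) Nat.one_div_pos_of_nat
    refine ⟨u, hd, ?_, ?_⟩
    · exact tendsto_iff_dist_tendsto_zero.2 (squeeze_zero (fun _ => dist_nonneg)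
        (fun k => (hu k).le) tendsto_one_div_add_atTop_nhds_zero_nat)
    · exact tendsto_iff_dist_tendsto_zero.2 (squeeze_zero (fun _ => dist_nonneg)
        (fun k => (hA k).le) tendsto_one_div_add_atTop_nhds_zero_nat)

theorem isClosed_derivLimits (f : X → G) (x : X) : IsClosed (derivLimits f x) := by
  refine isClosed_of_closure_subset fun A hA => mem_derivLimits_iff.2 fun ε hε => ?_
  obtain ⟨B, hB, hAB⟩ := Metric.mem_closure_iff.1 hA (ε / 2) (half_pos hε)
  obtain ⟨u, hd, hu, huB⟩ := mem_derivLimits_iff.1 hB (ε / 2) (half_pos hε)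
  refine ⟨u, hd, by linarith, ?_⟩
  have := dist_triangle_right (fderiv ℝ f u) A B
  linarith

variable {K : NNReal} {f : X → G} {x : X} {s : Set X}

theorem LipschitzOnWith.eventually_norm_fderiv_le (hf : LipschitzOnWith K f s) (hs : s ∈ 𝓝 x) :
    ∀ᶠ z in 𝓝 x, ‖fderiv ℝ f z‖ ≤ K :=
  (eventually_mem_nhds_iff.2 hs).mono fun _ hz => norm_fderiv_le_of_lipschitzOn ℝ hz hf

variable [FiniteDimensional ℝ X] [FiniteDimensional ℝ G]

theorem LipschitzOnWith.isCompact_derivLimits (hf : LipschitzOnWith K f s) (hs : s ∈ 𝓝 x) :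
    IsCompact (derivLimits f x) := by
  have : ProperSpace (X →L[ℝ] G) := FiniteDimensional.proper ℝ _
  refine (isCompact_closedBall (0 : X →L[ℝ] G) K).of_isClosed_subset (isClosed_derivLimits f x) ?_
  rintro A ⟨u, -, hu, hA⟩
  exact mem_closedBall_zero_iff.2
    (le_of_tendsto hA.norm (hu.eventually (hf.eventually_norm_fderiv_le hs)))

theorem LipschitzOnWith.isCompact_clarkeJacobian (hf : LipschitzOnWith K f s) (hs : s ∈ 𝓝 x) :
    IsCompact (clarkeJacobian f x) :=
  (hf.isCompact_derivLimits hs).convexHull_of_finiteDimensional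

/-- Outer semicontinuity of the Clarke Jacobian along points of differentiability. -/
theorem LipschitzOnWith.eventually_exists_mem_clarkeJacobian (hf : LipschitzOnWith K f s)
    (hs : s ∈ 𝓝 x) {ε : ℝ} (hε : 0 < ε) : ∀ᶠ z in 𝓝 x, DifferentiableAt ℝ f z →
      ∃ A ∈ clarkeJacobian f x, ‖fderiv ℝ f z - A‖ < ε := by
  have : ProperSpace (X →L[ℝ] G) := FiniteDimensional.proper ℝ _
  by_contra hcon
  rw [not_eventually] at hcon
  obtain ⟨u, hu, hbad⟩ := exists_seq_forall_of_frequently hcon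
  push Not at hbad
  obtain ⟨A, -, φ, hφ, hA⟩ := (isCompact_closedBall (0 : X →L[ℝ] G) K).tendsto_subseq'
    (x := fun k => fderiv ℝ f (u k)) ((hu.eventually
      (hf.eventually_norm_fderiv_le hs)).mono fun k hk => mem_closedBall_zero_iff.2 hk).frequently
  have hmem : A ∈ clarkeJacobian f x := subset_convexHull ℝ _
    ⟨u ∘ φ, fun k => (hbad _).1, hu.comp hφ.tendsto_atTop, hA⟩
  obtain ⟨k, hk⟩ := (Metric.tendsto_nhds.1 hA ε hε).exists
  rw [dist_eq_norm] at hk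
  exact absurd hk (not_lt.2 ((hbad _).2 A hmem))

end Clarke

/-! ### The partial Clarke Jacobian -/

section Partial

variable {E H G : Type*} [NormedAddCommGroup E] [NormedSpace ℝ E] [NormedAddCommGroup H]
  [NormedSpace ℝ H] [NormedAddCommGroup G] [NormedSpace ℝ G]

theorem partialClarkeJacobian_eq_image (F : E × H → G) (x : E) (y : H) :
    partialClarkeJacobian F x y = (fun A : E × H →L[ℝ] G =>
      A.comp (ContinuousLinearMap.inl ℝ E H)) '' clarkeJacobian F (x, y) := by
  ext M
  constructor
  · rintro ⟨N, hN⟩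
    exact ⟨_, hN, by simp⟩
  · rintro ⟨A, hA, rfl⟩
    refine ⟨A.comp (ContinuousLinearMap.inr ℝ E H), ?_⟩
    convert hA
    ext <;> simp

theorem convex_partialClarkeJacobian (F : E × H → G) (x : E) (y : H) :
    Convex ℝ (partialClarkeJacobian F x y) := by
  rw [partialClarkeJacobian_eq_image]
  exact (convex_convexHull ℝ _).is_linear_image
    ⟨fun A B => ContinuousLinearMap.add_comp _ _ _, fun c A => ContinuousLinearMap.smul_comp _ _ _⟩

variable [FiniteDimensional ℝ E] [FiniteDimensional ℝ H] [FiniteDimensional ℝ G]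
  {F : E × H → G}

theorem LocallyLipschitz.isCompact_partialClarkeJacobian (hF : LocallyLipschitz F) (x : E)
    (y : H) : IsCompact (partialClarkeJacobian F x y) := by
  obtain ⟨K, s, hs, hf⟩ := hF (x, y)
  rw [partialClarkeJacobian_eq_image]
  exact (hf.isCompact_clarkeJacobian hs).image (by fun_prop)

/-- A lower bound on the partial Clarke Jacobian at `(x, y)`, in a direction `v` and tested by a
functional `l`, gives a lower bound on nearby increments in the direction `v`. The neighbourhood
depends neither on `v` nor on `l`. -/
theorem LocallyLipschitz.exists_ball_partial_mean_value (hF : LocallyLipschitz F) (x : E) (y : H)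
    {ε : ℝ} (hε : 0 < ε) : ∃ r > 0, ∀ (v : E) (l : G →L[ℝ] ℝ) (a : ℝ),
      (∀ M ∈ partialClarkeJacobian F x y, a ≤ l (M v)) → ∀ (x' : E) (y' : H),
        (x', y') ∈ Metric.ball (x, y) r → (x' + v, y') ∈ Metric.ball (x, y) r →
          a - ε * ‖l‖ * ‖v‖ ≤ l (F (x' + v, y') - F (x', y')) := by
  obtain ⟨K, s, hs, hf⟩ := hF (x, y)
  obtain ⟨r, hr, hball⟩ := Metric.eventually_nhds_iff_ball.1
    ((hf.eventually_exists_mem_clarkeJacobian hs hε).and hs)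
  refine ⟨r, hr, fun v l a ha x' y' h1 h2 => ?_⟩
  have hadd : ((x', y') : E × H) + (v, 0) = (x' + v, y') := by simp
  rw [← hadd] at h2 ⊢
  refine (hf.mono fun z hz => (hball z hz).2).le_apply_sub_of_le_apply_fderiv
    Metric.isOpen_ball (convex_ball _ _) l (fun z hz hd => ?_) h1 h2
  obtain ⟨A, hA, hlt⟩ := (hball z hz).1 hd
  have h3 := ha (A.comp (ContinuousLinearMap.inl ℝ E H))
    (by rw [partialClarkeJacobian_eq_image]; exact ⟨A, hA, rfl⟩)
  simp only [ContinuousLinearMap.comp_apply, ContinuousLinearMap.inl_apply] at h3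
  have h4 : ‖l ((fderiv ℝ F z - A) (v, 0))‖ ≤ ‖l‖ * (ε * ‖v‖) := by
    refine (l.le_opNorm _).trans (mul_le_mul_of_nonneg_left ?_ (norm_nonneg l))
    refine ((fderiv ℝ F z - A).le_opNorm _).trans ?_
    rw [Prod.norm_mk, norm_zero, max_eq_left (norm_nonneg v)]
    gcongr
  have h5 := neg_le_of_abs_le h4
  rw [sub_apply, map_sub] at h5
  linarith

end Partial

/-! ### Coverings and global injectivity -/

/-- A connected covering space of a simply connected, locally path connected space is trivial. -/
theorem IsCoveringMap.injective_of_simplyConnected {E X : Type*} [TopologicalSpace E]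
    [TopologicalSpace X] [PreconnectedSpace E] [SimplyConnectedSpace X]
    [LocallyPathConnectedSpace X] {p : E → X} (hp : IsCoveringMap p) : Function.Injective p := by
  intro e₁ e₂ h
  obtain ⟨σ, ⟨hσ, hpσ⟩, -⟩ :=
    hp.existsUnique_continuousMap_lifts (ContinuousMap.id X) (p e₁) e₁ rfl
  -- Both sides lift `p` through itself and agree at `e₁`; so the section `σ` is a left inverse of
  -- `p`.
  have : σ ∘ p = id := hp.eq_of_comp_eq (σ.continuous.comp hp.continuous) continuous_id
    (by rw [← Function.comp_assoc, hpσ]; rfl) e₁ hσ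
  have h₁ := congrFun this e₁
  have h₂ := congrFun this e₂
  simp only [Function.comp_apply, id] at h₁ h₂
  rw [← h₁, ← h₂, h]

/-- Hadamard's global injectivity theorem: a proper local homeomorphism from a connected space to
a simply connected, locally path connected one is injective. -/
theorem IsLocalHomeomorph.injective_of_isProperMap {E X : Type*} [TopologicalSpace E] [T2Space E]
    [TopologicalSpace X] [T1Space X] [PreconnectedSpace E] [SimplyConnectedSpace X]
    [LocallyPathConnectedSpace X] {p : E → X} (hp : IsLocalHomeomorph p) (hpr : IsProperMap p) :
    Function.Injective p := by
  refine (isCoveringMap_iff_isCoveringMapOn_univ.2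
    (hpr.isClosedMap.isCoveringMapOn_of_isLocalHomeomorphOn (fun x _ => ?_)
      hp.isLocalHomeomorphOn)).injective_of_simplyConnected
  -- Fibres are compact by properness and discrete by local injectivity.
  refine (hpr.isCompact_preimage isCompact_singleton).finite
    (IsDiscrete.of_openPartialHomeomorph p subset_rfl fun e _ => ?_)
  obtain ⟨φ, hφ, h⟩ := hp e
  exact ⟨φ, hφ, h.symm⟩

/-! ### Local injectivity and local solvability -/

section Solvability

variable {E H G : Type*} [NormedAddCommGroup E] [InnerProductSpace ℝ E] [FiniteDimensional ℝ E]
  [NormedAddCommGroup H] [NormedSpace ℝ H] [FiniteDimensional ℝ H]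
  [NormedAddCommGroup G] [InnerProductSpace ℝ G] [FiniteDimensional ℝ G] {F : E × H → G}

/-- A compact set of injective linear maps is uniformly bounded below. -/
theorem IsCompact.exists_pos_mul_norm_le {V W : Type*} [NormedAddCommGroup V] [NormedSpace ℝ V]
    [FiniteDimensional ℝ V] [NormedAddCommGroup W] [NormedSpace ℝ W] {T : Set (V →L[ℝ] W)}
    (hT : IsCompact T) (hinj : ∀ M ∈ T, Function.Injective M) :
    ∃ c > 0, ∀ M ∈ T, ∀ v, c * ‖v‖ ≤ ‖M v‖ := by
  have : ProperSpace V := FiniteDimensional.proper ℝ V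
  obtain ⟨c, hc, hle⟩ := (hT.prod (isCompact_sphere (0 : V) 1)).exists_forall_le'
    (f := fun q : (V →L[ℝ] W) × V => ‖q.1 q.2‖) (a := 0) (by fun_prop) (by
      rintro ⟨M, v⟩ ⟨hM, hv⟩
      refine norm_pos_iff.2 fun h0 => ?_
      have : v = 0 := hinj M hM (h0.trans (map_zero M).symm)
      simp [this] at hv)
  refine ⟨c, hc, fun M hM v => ?_⟩
  rcases eq_or_ne v 0 with rfl | hv
  · simp
  have := hle (M, ‖v‖⁻¹ • v) ⟨hM, by simp [norm_smul, hv]⟩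
  simp only [map_smul, norm_smul, norm_inv, norm_norm] at this
  rwa [inv_mul_eq_div, le_div_iff₀ (norm_pos_iff.2 hv)] at this

/-- Nonsingularity of the partial Clarke Jacobian at a point yields a local lower Lipschitz bound
in the first variable. -/
theorem LocallyLipschitz.exists_ball_mul_norm_sub_le (hF : LocallyLipschitz F) {x : E} {y : H}
    (hrank : IsOfMaximalRank (partialClarkeJacobian F x y)) :
    ∃ c > 0, ∃ r > 0, ∀ (x₁ x₂ : E) (y' : H), (x₁, y') ∈ Metric.ball (x, y) r →
      (x₂, y') ∈ Metric.ball (x, y) r → c * ‖x₁ - x₂‖ ≤ ‖F (x₁, y') - F (x₂, y')‖ := by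
  have hT := hF.isCompact_partialClarkeJacobian x y
  obtain ⟨c, hc, hle⟩ := hT.exists_pos_mul_norm_le fun M hM => (hrank M hM).1
  obtain ⟨r, hr, hmv⟩ := hF.exists_ball_partial_mean_value x y (half_pos hc)
  refine ⟨c / 2, half_pos hc, r, hr, fun x₁ x₂ y' h₁ h₂ => ?_⟩
  set v := x₁ - x₂ with hv
  have hx : x₂ + v = x₁ := by simp [hv]
  have himg : Convex ℝ ((fun M : E →L[ℝ] G => M v) '' partialClarkeJacobian F x y) :=
    (convex_partialClarkeJacobian F x y).is_linear_image ⟨fun _ _ => rfl, fun _ _ => rfl⟩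
  -- The functional `w` depends on `v`, which is harmless since the radius `r` is uniform in both.
  obtain ⟨w, hw, hwle⟩ := himg.exists_le_inner_of_le_norm (δ := c * ‖v‖)
    (hT.image (by fun_prop)).isClosed (by rintro _ ⟨M, hM, rfl⟩; exact hle M hM v)
  have h := hmv v (innerSL ℝ w) (c * ‖v‖) (fun M hM => hwle _ ⟨M, hM, rfl⟩) x₂ y' h₂ (by rwa [hx])
  rw [hx, innerSL_apply_norm, innerSL_apply_apply] at h
  have h3 := (real_inner_le_norm w (F (x₁, y') - F (x₂, y'))).trans
    (mul_le_of_le_one_left (norm_nonneg _) hw)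
  have h4 : c / 2 * ‖w‖ * ‖v‖ ≤ c / 2 * ‖v‖ := by
    gcongr
    exact mul_le_of_le_one_right (half_pos hc).le hw
  linarith

/-- A local minimizer of `‖F (·, y) - p‖` at which the partial Clarke Jacobian is nonsingular solves
`F (x, y) = p`. -/
theorem LocallyLipschitz.eq_of_isLocalMin_norm_sub (hF : LocallyLipschitz F) {x : E} {y : H}
    (hrank : IsOfMaximalRank (partialClarkeJacobian F x y)) {p : G}
    (hmin : IsLocalMin (fun x' => ‖F (x', y) - p‖) x) : F (x, y) = p := by
  by_contra hne
  set q := F (x, y) - p with hq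
  have hq0 : q ≠ 0 := sub_ne_zero.2 hne
  have hqpos := norm_pos_iff.2 hq0
  have hT := hF.isCompact_partialClarkeJacobian x y
  set C := (fun M : E →L[ℝ] G => ContinuousLinearMap.adjoint M q) '' partialClarkeJacobian F x y
  have hCconv : Convex ℝ C := (convex_partialClarkeJacobian F x y).is_linear_image
    ⟨fun A B => by simp, fun a A => by simp⟩
  have hCcomp : IsCompact C := hT.image (by fun_prop)
  obtain ⟨δ, hδ, hδle⟩ := hCcomp.exists_forall_le' (f := fun c : E => ‖c‖) (a := 0)
    (by fun_prop) (by
      rintro _ ⟨M, hM, rfl⟩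
      refine norm_pos_iff.2 fun h0 => hq0 ?_
      obtain ⟨z, hz⟩ := (hrank M hM).2 q
      have := ContinuousLinearMap.adjoint_inner_left M z q
      rw [show ContinuousLinearMap.adjoint M q = 0 from h0, hz, inner_zero_left] at this
      exact inner_self_eq_zero.1 this.symm)
  obtain ⟨w, hw, hwle⟩ := hCconv.exists_le_inner_of_le_norm hCcomp.isClosed hδle
  obtain ⟨r, hr, hmv⟩ := hF.exists_ball_partial_mean_value x y
    (ε := δ / (2 * ‖q‖)) (by positivity)
  obtain ⟨K, s, hs, hLip⟩ := hF (x, y)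
  have hpath : Tendsto (fun t : ℝ => x - t • w) (𝓝[>] 0) (𝓝 x) :=
    (Continuous.tendsto' (by fun_prop) _ _ (by simp)).mono_left nhdsWithin_le_nhds
  have hpath2 : Tendsto (fun t : ℝ => (x - t • w, y)) (𝓝[>] 0) (𝓝 (x, y)) :=
    hpath.prodMk_nhds tendsto_const_nhds
  -- The step `-t • w` changes the squared residual by at most `-t * δ + K ^ 2 * t ^ 2`, which this
  -- makes negative.
  have hsmall : ∀ᶠ t : ℝ in 𝓝[>] 0, (K : ℝ) ^ 2 * t < δ := by
    have : Tendsto (fun t : ℝ => (K : ℝ) ^ 2 * t) (𝓝[>] 0) (𝓝 0) :=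
      (Continuous.tendsto' (by fun_prop) _ _ (by simp)).mono_left nhdsWithin_le_nhds
    exact this.eventually (gt_mem_nhds hδ)
  obtain ⟨t, hmint, hball, hts, ht, htpos⟩ := ((hpath.eventually hmin).and
    ((hpath2.eventually (Metric.ball_mem_nhds _ hr)).and ((hpath2.eventually hs).and
      (hsmall.and self_mem_nhdsWithin)))).exists
  have htpos : 0 < t := htpos
  have hx : x - t • w + t • w = x := by simp
  have h1 := hmv (t • w) (innerSL ℝ q) (t * δ) (fun M hM => by
    have := hwle _ ⟨M, hM, rfl⟩
    rw [ContinuousLinearMap.adjoint_inner_right, real_inner_comm] at this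
    rw [innerSL_apply_apply, map_smul, real_inner_smul_right]
    gcongr) (x - t • w) y hball (by rw [hx]; exact Metric.mem_ball_self hr)
  rw [hx, innerSL_apply_norm, innerSL_apply_apply, norm_smul, Real.norm_eq_abs,
    abs_of_pos htpos] at h1
  set D := F (x, y) - F (x - t • w, y) with hD
  have h2 : δ / (2 * ‖q‖) * ‖q‖ * (t * ‖w‖) ≤ t * δ / 2 := by
    have : δ / (2 * ‖q‖) * ‖q‖ = δ / 2 := by field_simp
    rw [this]
    have := mul_le_mul_of_nonneg_left hw (by positivity : 0 ≤ δ / 2 * t)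
    linarith
  have h3 : ‖D‖ ≤ K * t := by
    have := hLip.dist_le_mul _ (mem_of_mem_nhds hs) _ hts
    rw [dist_eq_norm, Prod.dist_eq, dist_self, dist_eq_norm, sub_sub_cancel,
      max_eq_left (norm_nonneg _), norm_smul, Real.norm_eq_abs, abs_of_pos htpos] at this
    refine this.trans (mul_le_mul_of_nonneg_left ?_ K.coe_nonneg)
    exact mul_le_of_le_one_right htpos.le hw
  have h4 : ‖q‖ ≤ ‖q - D‖ := by
    have : q - D = F (x - t • w, y) - p := by rw [hq, hD]; abel
    rw [this]
    exact hmint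
  have h5 := norm_sub_sq_real q D
  have h6 : ‖q‖ ^ 2 ≤ ‖q - D‖ ^ 2 := by gcongr
  have h7 : ‖D‖ ^ 2 ≤ (K * t) ^ 2 := by gcongr
  nlinarith

/-- Local solvability of `F (x', y') = p'` near a point with nonsingular partial Clarke Jacobian. -/
theorem LocallyLipschitz.exists_mem_ball_eq (hF : LocallyLipschitz F)
    (hrank : ∀ x y, IsOfMaximalRank (partialClarkeJacobian F x y)) (x : E) (y : H) {r : ℝ}
    (hr : 0 < r) : ∃ ε > 0, ∀ y' ∈ Metric.ball y ε, ∀ p ∈ Metric.ball (F (x, y)) ε,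
      ∃ x' ∈ Metric.ball x r, F (x', y') = p := by
  have : ProperSpace E := FiniteDimensional.proper ℝ E
  obtain ⟨c, hc, R, hR, hlow⟩ := hF.exists_ball_mul_norm_sub_le (hrank x y)
  obtain ⟨ρ, hρ, hρlt⟩ := exists_between (lt_min hR hr)
  have hρR := hρlt.trans_le (min_le_left _ _)
  have hcρ : 0 < c * ρ / 4 := by positivity
  obtain ⟨η, hη, hcont⟩ := Metric.eventually_nhds_iff_ball.1 (Metric.tendsto_nhds.1
    ((hF.continuous.comp (Continuous.prodMk_right x)).tendsto y) _ hcρ)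
  refine ⟨min η (min ρ (c * ρ / 4)), by positivity, fun y' hy' p hp => ?_⟩
  rw [Metric.mem_ball, lt_min_iff, lt_min_iff] at hy' hp
  have h0 : ‖F (x, y') - p‖ < c * ρ / 2 := by
    have h1 : dist (F (x, y')) (F (x, y)) < c * ρ / 4 := hcont y' hy'.1
    have h2 := dist_triangle_right (F (x, y')) p (F (x, y))
    rw [← dist_eq_norm]
    linarith [hp.2.2]
  have hFc := hF.continuous
  obtain ⟨x', hx', hmin⟩ := (isCompact_closedBall x ρ).exists_isMinOn
    ⟨x, Metric.mem_closedBall_self hρ.le⟩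
    (f := fun x' => ‖F (x', y') - p‖) (by fun_prop)
  -- On the sphere `F (·, y')` differs from its value at the centre by at least `c * ρ`, while the
  -- residual at the centre is below `c * ρ / 2`; so no minimizer lies there.
  have hxb : x' ∈ Metric.ball x ρ := by
    refine lt_of_le_of_ne (Metric.mem_closedBall.1 hx') fun heq => ?_
    have h1 := hlow x' x y' (by
      rw [Metric.mem_ball, Prod.dist_eq, max_lt_iff]
      exact ⟨heq.trans_lt hρR, hy'.2.1.trans hρR⟩) (by
      rw [Metric.mem_ball, Prod.dist_eq, max_lt_iff, dist_self]
      exact ⟨hR, hy'.2.1.trans hρR⟩)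
    rw [← dist_eq_norm x', heq] at h1
    have h2 : ‖F (x', y') - p‖ ≤ ‖F (x, y') - p‖ := hmin (Metric.mem_closedBall_self hρ.le)
    have h3 := norm_sub_le_norm_sub_add_norm_sub (F (x', y')) p (F (x, y'))
    rw [norm_sub_rev p] at h3
    linarith
  refine ⟨x', Metric.ball_subset_ball (hρlt.trans_le (min_le_right _ _)).le hxb,
    hF.eq_of_isLocalMin_norm_sub (hrank x' y') ?_⟩
  exact (hmin.on_subset Metric.ball_subset_closedBall).isLocalMin (Metric.isOpen_ball.mem_nhds hxb)

/-- Local solvability with `y` fixed gives openness; the lower Lipschitz bound gives local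
injectivity. -/
theorem LocallyLipschitz.isLocalHomeomorph_slice (hF : LocallyLipschitz F)
    (hrank : ∀ x y, IsOfMaximalRank (partialClarkeJacobian F x y)) (y : H) :
    IsLocalHomeomorph fun x => F (x, y) := by
  have hFc := hF.continuous
  have hopen : IsOpenMap fun x => F (x, y) := by
    refine IsOpenMap.of_nhds_le fun x s hs => ?_
    obtain ⟨r, hr, hsub⟩ := Metric.mem_nhds_iff.1 (mem_map.1 hs)
    obtain ⟨ε, hε, h⟩ := hF.exists_mem_ball_eq hrank x y hr
    refine mem_of_superset (Metric.ball_mem_nhds _ hε) fun p hp => ?_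
    obtain ⟨x', hx', rfl⟩ := h y (Metric.mem_ball_self hε) p hp
    exact hsub hx'
  refine isLocalHomeomorph_iff_isOpenEmbedding_restrict.2 fun x => ?_
  obtain ⟨c, hc, r, hr, hlow⟩ := hF.exists_ball_mul_norm_sub_le (hrank x y)
  refine ⟨Metric.ball x r, Metric.ball_mem_nhds _ hr,
    isOpenEmbedding_iff_continuous_injective_isOpenMap.2 ⟨?_, ?_, hopen.domRestrict
      Metric.isOpen_ball⟩⟩
  · exact (by fun_prop : Continuous fun x => F (x, y)).comp continuous_subtype_val
  · refine Set.injOn_iff_injective.1 fun x₁ h₁ x₂ h₂ heq => ?_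
    have h := hlow x₁ x₂ y (by simpa [Prod.dist_eq, hr] using h₁)
      (by simpa [Prod.dist_eq, hr] using h₂)
    rw [show F (x₁, y) = F (x₂, y) from heq, sub_self, norm_zero] at h
    have : ‖x₁ - x₂‖ ≤ 0 := nonpos_of_mul_nonpos_right h hc
    exact sub_eq_zero.1 (norm_le_zero_iff.1 this)

end Solvability

/-! ### Properness and the implicit function -/

theorem IsCoerciveFunctional.tendsto_cocompact {E G : Type*} [NormedAddCommGroup E] [ProperSpace E]
    [NormedAddCommGroup G] [ProperSpace G] {g : E → G}
    (h : IsCoerciveFunctional fun x => (1 / 2 : ℝ) * ‖g x‖ ^ 2) :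
    Tendsto g (cocompact E) (cocompact G) := by
  rw [← Metric.cobounded_eq_cocompact, ← Metric.cobounded_eq_cocompact,
    ← tendsto_norm_atTop_iff_cobounded, ← comap_norm_atTop]
  refine tendsto_atTop.2 fun b => ?_
  filter_upwards [tendsto_atTop.1 h ((1 / 2 : ℝ) * b ^ 2)] with x hx
  exact le_of_abs_le (abs_le_of_sq_le_sq (by linarith) (norm_nonneg _))

theorem theorem4 (n m : ℕ)
    (F : EuclideanSpace ℝ (Fin n) × EuclideanSpace ℝ (Fin m) → EuclideanSpace ℝ (Fin n))
    (hF : LocallyLipschitz F)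
    (hcoercive : ∀ y : EuclideanSpace ℝ (Fin m),
      IsCoerciveFunctional (fun x : EuclideanSpace ℝ (Fin n) => (1 / 2 : ℝ) * ‖F (x, y)‖ ^ 2))
    (hrank : ∀ (x : EuclideanSpace ℝ (Fin n)) (y : EuclideanSpace ℝ (Fin m)),
      IsOfMaximalRank (partialClarkeJacobian F x y)) :
    ∃! f : EuclideanSpace ℝ (Fin m) → EuclideanSpace ℝ (Fin n),
      LocallyLipschitz f ∧
        ∀ (x : EuclideanSpace ℝ (Fin n)) (y : EuclideanSpace ℝ (Fin m)),
          F (x, y) = 0 ↔ x = f y := by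
  have hFc := hF.continuous
  have hprop : ∀ y, IsProperMap fun x => F (x, y) := fun y =>
    isProperMap_iff_tendsto_cocompact.2 ⟨by fun_prop, (hcoercive y).tendsto_cocompact⟩
  have hinj : ∀ y, Function.Injective fun x => F (x, y) := fun y =>
    (hF.isLocalHomeomorph_slice hrank y).injective_of_isProperMap (hprop y)
  have hex : ∀ y, ∃ x, F (x, y) = 0 := fun y => by
    obtain ⟨x, hx⟩ := (by fun_prop : Continuous fun x => ‖F (x, y)‖).exists_forall_le
      (tendsto_norm_cocompact_atTop.comp (hcoercive y).tendsto_cocompact)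
    exact ⟨x, hF.eq_of_isLocalMin_norm_sub (hrank x y)
      (Eventually.of_forall fun x' => by simpa using hx x')⟩
  choose f hf using hex
  have hiff : ∀ x y, F (x, y) = 0 ↔ x = f y := fun x y =>
    ⟨fun h => hinj y (h.trans (hf y).symm), fun h => h ▸ hf y⟩
  refine ⟨f, ⟨fun y => ?_, hiff⟩, fun g hg => funext fun y => (hiff _ _).1 ((hg.2 _ _).2 rfl)⟩
  obtain ⟨c, hc, r, hr, hlow⟩ := hF.exists_ball_mul_norm_sub_le (hrank (f y) y)
  obtain ⟨K, s, hs, hLip⟩ := hF (f y, y)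
  obtain ⟨R, hR, hRs⟩ := Metric.mem_nhds_iff.1 hs
  obtain ⟨ε, hε, hsolve⟩ := hF.exists_mem_ball_eq hrank (f y) y (lt_min hr hR)
  set τ := min ε (min r R)
  have hτ : 0 < τ := by positivity
  have hmem : ∀ y₁ ∈ Metric.ball y τ, ∀ y₂ ∈ Metric.ball y τ,
      (f y₁, y₂) ∈ Metric.ball (f y, y) (min r R) := by
    intro y₁ h₁ y₂ h₂
    obtain ⟨x', hx', h⟩ := hsolve y₁ (Metric.ball_subset_ball (min_le_left _ _) h₁) 0
      (by rw [hf]; exact Metric.mem_ball_self hε)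
    rw [(hiff _ _).1 h] at hx'
    rw [Metric.mem_ball, Prod.dist_eq, max_lt_iff]
    exact ⟨hx', Metric.ball_subset_ball (min_le_right _ _) h₂⟩
  refine ⟨K / c.toNNReal, Metric.ball y τ, Metric.ball_mem_nhds _ hτ,
    LipschitzOnWith.of_dist_le_mul fun y₁ h₁ y₂ h₂ => ?_⟩
  -- Both points are compared at the common parameter `y₁`: `c * ‖f y₁ - f y₂‖ ≤ ‖F (f y₂, y₁)‖`. As
  -- `F (f y₂, y₂) = 0`, the right side is at most `K * dist y₁ y₂`, whence the constant `K / c`.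
  have h3 := hlow (f y₁) (f y₂) y₁ (Metric.ball_subset_ball (min_le_left _ _) (hmem _ h₁ _ h₁))
    (Metric.ball_subset_ball (min_le_left _ _) (hmem _ h₂ _ h₁))
  have h4 := hLip.dist_le_mul _
    (hRs (Metric.ball_subset_ball (min_le_right _ _) (hmem _ h₂ _ h₁))) _
    (hRs (Metric.ball_subset_ball (min_le_right _ _) (hmem _ h₂ _ h₂)))
  rw [hf, zero_sub, norm_neg, ← dist_eq_norm] at h3
  rw [hf y₂, Prod.dist_eq, dist_self, max_eq_right dist_nonneg, dist_zero_right] at h4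
  rw [NNReal.coe_div, Real.coe_toNNReal c hc.le, div_mul_eq_mul_div, le_div_iff₀ hc]
  linarith
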